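/- **Theorem 4.3 (with Remark 4.4(i)).** Let $d\ge 1$. There is a free, rank-one, infinite measure preserving action $T=(T_\gamma)_{\gamma\in\mathbb Z^d}$ of $\mathbb Z^d$ on a $\sigma$-finite standard measure space $(X,\mathfrak B,\mu)$ such that $\mathcal R(T)=P(\mathbb R^d)$. Moreover, there is a free, rank-one, infinite measure preserving action $T$ of $\mathbb Z^d$ on such a space with $\mathcal Ri(T)=P(\mathbb R^d)$. Here $P(\mathbb R^d)$ is the set of lines through the origin in $\mathbb R^d$, $\operatorname{dist}$ is the Euclidean distance, and: * $T$ is *infinite measure preserving* if every $T_\gamma$ preserves $\mu$ and $\mu(X)=\infty$; it is *free* if $T_\gamma x\ne x$ for all $x\in X$ and $\gamma\ne0$. * $T$ is of *rank one* if there are measurable sets $A_n$ of finite measure and cubes $F_n=\{0,\dots,h_n-1\}^d\subset\mathbb Z^d$ such that for each $n$ the sets $T_\gamma A_n$, $\gamma\in F_n$, are pairwise disjoint, and for each measurable $B$ with $\mu(B)<\infty$ one has $\min_{J\subset F_n}\mu\bigl(B\,\triangle\,\bigcup_{\gamma\in J}T_\gamma A_n\bigr)\to0$ as $n\to\infty$.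 * $\mathcal R(T)$ is the set of $\theta\in P(\mathbb R^d)$ along which $T$ is *recurrent*: for each $\epsilon>0$ and each measurable $A$ with $\mu(A)>0$ there are $\gamma\in\mathbb Z^d\setminus\{0\}$ and $g\in\theta$ with $\operatorname{dist}(\gamma,g)<\epsilon$ and $\mu(A\cap T_\gamma A)>0$. * $\mathcal Ri(T)$ is the set of $\theta\in P(\mathbb R^d)$ along which $T$ is *rigid*: there is a sequence $(\gamma_n)_{n\ge1}$ in $\mathbb Z^d$ with $\gamma_n\to\infty$, $\inf_{g\in\theta}\operatorname{dist}(\gamma_n,g)\to0$, and $\mu(A\cap T_{\gamma_n}A)\to\mu(A)$ for each measurable $A$ with $\mu(A)<\infty$. -/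

import Mathlib

open MeasureTheory Filter Topology
open scoped symmDiff

/-! Measure preserving actions of `ℤ^d` are Mathlib's additive actions of `Fin d → ℤ` by measurable
maps (`MeasurableConstVAdd`) which leave a measure invariant (`VAddInvariantMeasure`);
`T_γ x` is `γ +ᵥ x`. -/

namespace DirectionalRecurrence

/-- The projective space `P(ℝ^d)` of lines through the origin in Euclidean space. -/
abbrev Directions (d : ℕ) : Type :=
  Projectivization ℝ (EuclideanSpace ℝ (Fin d))

/-- A lattice point of `ℤ^d`, regarded as a vector of Euclidean space `ℝ^d`. -/
noncomputable def latticePoint {d : ℕ} (γ : Fin d → ℤ) : EuclideanSpace ℝ (Fin d) :=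
  WithLp.toLp 2 (fun i => (γ i : ℝ))

/-- The image `T_γ A` of a set under the element `γ` of `ℤ^d`. -/
def translateSet {d : ℕ} {X : Type*} [AddAction (Fin d → ℤ) X] (γ : Fin d → ℤ) (A : Set X) : Set X :=
  (fun x => γ +ᵥ x) '' A

/-- The action is free: only `0` has a fixed point. -/
def IsFreeAction (d : ℕ) (X : Type*) [AddAction (Fin d → ℤ) X] : Prop :=
  ∀ (γ : Fin d → ℤ) (x : X), γ +ᵥ x = x → γ = 0

/-- The cube `{0, …, h - 1}^d` in `ℤ^d`. -/
noncomputable def cube (d h : ℕ) : Finset (Fin d → ℤ) :=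
  Fintype.piFinset (fun _ => Finset.Ico (0 : ℤ) (h : ℤ))

/-- The action is of rank one: there is a sequence of Rokhlin towers, with bases `A n` of finite
measure and with pairwise disjoint levels `T_γ (A n)` indexed by the points `γ` of a cube, such that
every set of finite measure is approximated by unions of levels of the `n`-th tower as `n → ∞`.
(Using cubes with a corner at `0` is no restriction: translating the cube amounts to
replacing the base by one of its translates.) -/
def IsRankOne (d : ℕ) {X : Type*} [MeasurableSpace X] [AddAction (Fin d → ℤ) X]
    (μ : Measure X) : Prop :=
  ∃ (A : ℕ → Set X) (h : ℕ → ℕ),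
    (∀ n, MeasurableSet (A n) ∧ μ (A n) < ⊤) ∧
    (∀ n, (cube d (h n) : Set (Fin d → ℤ)).PairwiseDisjoint (fun γ => translateSet γ (A n))) ∧
    ∀ B : Set X, MeasurableSet B → μ B < ⊤ → ∀ ε : ENNReal, 0 < ε →
      ∀ᶠ n in atTop, ∃ J : Finset (Fin d → ℤ), J ⊆ cube d (h n) ∧
        μ (B ∆ ⋃ γ ∈ J, translateSet γ (A n)) < ε

/-- The action is recurrent along the line `θ`. -/
def IsRecurrentAlong {d : ℕ} {X : Type*} [MeasurableSpace X] [AddAction (Fin d → ℤ) X]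
    (μ : Measure X) (θ : Directions d) : Prop :=
  ∀ ε : ℝ, 0 < ε → ∀ A : Set X, MeasurableSet A → 0 < μ A →
    ∃ γ : Fin d → ℤ, γ ≠ 0 ∧ (∃ g ∈ θ.submodule, dist (latticePoint γ) g < ε) ∧
      0 < μ (A ∩ translateSet γ A)

/-- The action is rigid along the line `θ`: there is a sequence `γ n → ∞` in `ℤ^d` whose distance to
`θ` tends to `0` and with `μ (A ∩ T_{γ n} A) → μ A` for all `A` of finite measure. -/
def IsRigidAlong {d : ℕ} {X : Type*} [MeasurableSpace X] [AddAction (Fin d → ℤ) X]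
    (μ : Measure X) (θ : Directions d) : Prop :=
  ∃ γ : ℕ → (Fin d → ℤ),
    Tendsto γ atTop cofinite ∧
    Tendsto (fun n => Metric.infDist (latticePoint (γ n))
      (θ.submodule : Set (EuclideanSpace ℝ (Fin d)))) atTop (𝓝 0) ∧
    ∀ A : Set X, MeasurableSet A → μ A < ⊤ →
      Tendsto (fun n => μ (A ∩ translateSet (γ n) A)) atTop (𝓝 (μ A))

/-- The set `R(T)` of recurrent directions. -/
def recurrentDirections (d : ℕ) {X : Type*} [MeasurableSpace X] [AddAction (Fin d → ℤ) X]
    (μ : Measure X) : Set (Directions d) :=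
  {θ | IsRecurrentAlong μ θ}

/-- The set `Ri(T)` of rigid directions. -/
def rigidDirections (d : ℕ) {X : Type*} [MeasurableSpace X] [AddAction (Fin d → ℤ) X]
    (μ : Measure X) : Set (Directions d) :=
  {θ | IsRigidAlong μ θ}

end DirectionalRecurrence

/-! By Dirichlet's theorem, every line passes within `ε` of a nonzero lattice vector `p` of size
at most `R(ε)`. A cube of side length `L` much larger than `R` is therefore almost invariant under
one such vector for each of the lines at once. Build a `(C, F)`-action by cutting and stacking,
where the copies of the `n`-th tower are translates by the points `m • t`, with `t` in such a cube
and `m` larger than the tower. The translation by `m • p` then permutes these copies up to a few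
of them, so it moves each union of levels of the `n`-th tower only a little, and it still follows
the line if `ε` is small compared with `1 / m`. Hence every direction is rigid, and thus
recurrent. The empty space left between the copies makes the measure infinite. -/

open ProbabilityTheory
open scoped Pointwise ENNReal

namespace DirectionalRecurrence

/-! ### Lattice points near lines -/

theorem exists_norm_nsmul_sub_intCast_le {ι : Type*} [Fintype ι] (v : ι → ℝ) {N : ℕ} (hN : 0 < N) :
    ∃ j ∈ Set.Icc 1 (N ^ Fintype.card ι), ∃ p : ι → ℤ,
      ‖(j : ℝ) • v - (fun i => (p i : ℝ))‖ ≤ 1 / N := by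
  have hN1 : (1 : ℝ) ≤ N := by exact_mod_cast hN
  have hvol : volume (Set.univ : Set (ι → UnitAddCircle)) ≤
      (N ^ Fintype.card ι + 1) •
        volume (Metric.closedBall (0 : ι → UnitAddCircle) (1 / N / 2)) := by
    rw [volume_pi_closedBall _ (by positivity)]
    simp only [AddCircle.volume_closedBall, mul_div_cancel₀ _ (two_ne_zero' ℝ), Finset.prod_const,
      min_eq_right ((div_le_one (by positivity)).2 hN1), Finset.card_univ, volume_pi,
      Measure.pi_univ, UnitAddCircle.measure_univ, one_pow, nsmul_eq_mul, ENNReal.ofReal_div_of_pos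
        (show (0 : ℝ) < N by positivity), ENNReal.ofReal_one, ENNReal.ofReal_natCast]
    push_cast
    rw [add_mul, ← mul_pow, ENNReal.mul_div_cancel (by positivity) (by simp), one_pow]
    exact le_self_add
  obtain ⟨j, hj, hjv⟩ := NormedAddCommGroup.exists_norm_nsmul_le
    (fun i => (v i : UnitAddCircle)) (by positivity) (1 / N : ℝ) hvol
  refine ⟨j, hj, fun i => round (j * v i), (pi_norm_le_iff_of_nonneg (by positivity)).2 fun i => ?_⟩
  have hi := (norm_le_pi_norm _ i).trans hjv
  rw [Pi.smul_apply, ← AddCircle.coe_nsmul, UnitAddCircle.norm_eq, nsmul_eq_mul] at hi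
  simpa using hi

theorem exists_forall_norm_le_infDist_latticePoint_le (d : ℕ) {ε : ℝ} (hε : 0 < ε) :
    ∃ R : ℕ, ∀ θ : Directions d, ∃ p : Fin d → ℤ, p ≠ 0 ∧ ‖p‖ ≤ R ∧
      Metric.infDist (latticePoint p) θ.submodule ≤ ε := by
  set K : NNReal := (Fintype.card (Fin d) : NNReal) ^ (1 / (2 : ENNReal)).toReal
  obtain ⟨N, hN⟩ := exists_nat_gt (max 1 (K / ε))
  obtain ⟨hN1, hNK⟩ := max_lt_iff.1 hN
  have hN0 : (0 : ℝ) < N := one_pos.trans hN1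
  have hinv : 1 / (N : ℝ) < 1 := (div_lt_one hN0).2 hN1
  refine ⟨N ^ d + 1, fun θ => ?_⟩
  set v : Fin d → ℝ := ‖θ.rep.ofLp‖⁻¹ • θ.rep.ofLp
  have hv : ‖v‖ = 1 :=
    norm_smul_inv_norm (𝕜 := ℝ) fun h => θ.rep_nonzero (WithLp.ofLp_injective 2 h)
  have hvθ (j : ℕ) : WithLp.toLp 2 ((j : ℝ) • v) ∈ θ.submodule := by
    rw [θ.submodule_eq]
    exact Submodule.smul_mem _ (j : ℝ)
      (Submodule.smul_mem _ (‖θ.rep.ofLp‖⁻¹) (Submodule.mem_span_singleton_self θ.rep))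
  obtain ⟨j, ⟨hj1, hjN⟩, p, hp⟩ := exists_norm_nsmul_sub_intCast_le v (Nat.cast_pos.1 hN0)
  have hjv : ‖(j : ℝ) • v‖ = j := by rw [norm_smul, hv, mul_one, Real.norm_natCast]
  have hpnorm : ‖(fun i => (p i : ℝ))‖ = ‖p‖ := rfl
  refine ⟨p, ?_, ?_, ?_⟩
  · rintro rfl
    have h : (j : ℝ) ≤ 1 / N := by simpa [← Pi.zero_def, hjv, -one_div] using hp
    have : (1 : ℝ) ≤ j := by exact_mod_cast hj1
    linarith
  · have hjN' : (j : ℝ) ≤ N ^ d := by exact_mod_cast hjN.trans_eq (by rw [Fintype.card_fin])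
    rw [← hpnorm]
    push_cast
    linarith [norm_le_norm_add_norm_sub ((j : ℝ) • v) (fun i => (p i : ℝ))]
  · calc Metric.infDist (latticePoint p) θ.submodule
        ≤ dist (latticePoint p) (WithLp.toLp 2 ((j : ℝ) • v)) :=
          Metric.infDist_le_dist_of_mem (hvθ j)
      _ ≤ K * dist (fun i => (p i : ℝ)) ((j : ℝ) • v) :=
          (PiLp.lipschitzWith_toLp 2 (fun _ : Fin d => ℝ)).dist_le_mul _ _
      _ ≤ K * (1 / N) := by rw [dist_comm, dist_eq_norm]; gcongr
      _ ≤ ε := by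
        rw [mul_one_div, div_le_iff₀ hN0, mul_comm]
        exact ((div_lt_iff₀ hε).1 hNK).le

theorem latticePoint_nsmul {d : ℕ} (m : ℕ) (p : Fin d → ℤ) :
    latticePoint (m • p) = (m : ℝ) • latticePoint p := by
  ext i
  simp [latticePoint]

theorem infDist_latticePoint_nsmul {d m : ℕ} (hm : m ≠ 0) (p : Fin d → ℤ)
    (V : Submodule ℝ (EuclideanSpace ℝ (Fin d))) :
    Metric.infDist (latticePoint (m • p)) V = m * Metric.infDist (latticePoint p) V := by
  have hm' : (m : ℝ) ≠ 0 := Nat.cast_ne_zero.2 hm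
  have hV : (m : ℝ) • (V : Set (EuclideanSpace ℝ (Fin d))) = V := by
    ext x
    rw [Set.mem_smul_set_iff_inv_smul_mem₀ hm', SetLike.mem_coe, V.smul_mem_iff (inv_ne_zero hm')]
    rfl
  conv_lhs => rw [latticePoint_nsmul, ← hV, infDist_smul₀ hm', Real.norm_natCast]

/-! ### Cubes -/

theorem mem_cube {d L : ℕ} {f : Fin d → ℤ} : f ∈ cube d L ↔ ∀ i, 0 ≤ f i ∧ f i < L := by
  simp [cube]

theorem card_cube (d L : ℕ) : (cube d L).card = L ^ d := by
  simp [cube]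

theorem card_cube_sdiff_vadd_le {d L : ℕ} {R : ℕ} (hL : 0 < L) (hRL : R ≤ L) {p : Fin d → ℤ}
    (hp : ‖p‖ ≤ R) :
    ((cube d L \ (p +ᵥ cube d L)).card : ℝ) ≤ d * R / L * (cube d L).card := by
  have hL' : (0 : ℝ) < L := by exact_mod_cast hL
  have hpi (i : Fin d) : -(R : ℤ) ≤ p i ∧ p i ≤ R := by
    have h := (norm_le_pi_norm p i).trans hp
    rw [Int.norm_eq_abs] at h
    exact abs_le.1 (by exact_mod_cast h)
  have hinter : (L - R) ^ d ≤ (cube d L ∩ (p +ᵥ cube d L)).card := by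
    rw [← card_cube, ← Finset.card_vadd_finset (fun i => max 0 (p i))]
    refine Finset.card_le_card fun x hx => ?_
    rw [← Finset.neg_vadd_mem_iff, mem_cube] at hx
    rw [Finset.mem_inter, ← Finset.neg_vadd_mem_iff, mem_cube, mem_cube]
    refine ⟨fun i => ?_, fun i => ?_⟩ <;> have := hx i <;> have := hpi i <;>
      simp only [vadd_eq_add, Pi.add_apply, Pi.neg_apply] at * <;> omega
  have hbernoulli : 1 - d * R / L ≤ (1 - R / L : ℝ) ^ d := by
    have h : (R / L : ℝ) ≤ 1 := (div_le_one hL').2 (by exact_mod_cast hRL)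
    calc (1 - d * R / L : ℝ) = 1 + d * -(R / L) := by ring
      _ ≤ (1 + -(R / L)) ^ d := one_add_mul_le_pow (by linarith) d
      _ = (1 - R / L) ^ d := by rw [← sub_eq_add_neg]
  have hcard : ((cube d L \ (p +ᵥ cube d L)).card : ℝ) +
      (cube d L ∩ (p +ᵥ cube d L)).card = (L : ℝ) ^ d := by
    exact_mod_cast (Finset.card_sdiff_add_card_inter _ _).trans (card_cube d L)
  calc ((cube d L \ (p +ᵥ cube d L)).card : ℝ)
      ≤ L ^ d - ((L - R : ℕ) : ℝ) ^ d := by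
        have : ((L - R : ℕ) : ℝ) ^ d ≤ (cube d L ∩ (p +ᵥ cube d L)).card := by
          exact_mod_cast hinter
        linarith
    _ = (1 - (1 - R / L) ^ d) * L ^ d := by
        rw [Nat.cast_sub hRL, sub_mul, one_mul, ← mul_pow, sub_mul, div_mul_cancel₀ _ hL'.ne',
          one_mul]
    _ ≤ d * R / L * L ^ d := by gcongr; linarith
    _ = d * R / L * (cube d L).card := by rw [card_cube, Nat.cast_pow]

/-- The cube of side length `L` is `ε`-almost invariant under some nonzero lattice vector in the
`ε`-neighbourhood of each line. This is what makes the translation by that vector nearly preserve a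
union of levels when `L` copies of a tower are stacked along each axis. -/
def IsAlmostInvariantCube (d : ℕ) (ε : ℝ) (L : ℕ) : Prop :=
  ∀ θ : Directions d, ∃ p : Fin d → ℤ, p ≠ 0 ∧ Metric.infDist (latticePoint p) θ.submodule ≤ ε ∧
    ((cube d L \ (p +ᵥ cube d L)).card : ℝ) ≤ ε * (cube d L).card

theorem exists_isAlmostInvariantCube (d : ℕ) {ε : ℝ} (hε : 0 < ε) :
    ∃ L, 0 < L ∧ IsAlmostInvariantCube d ε L := by
  obtain ⟨R, hR⟩ := exists_forall_norm_le_infDist_latticePoint_le d hε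
  obtain ⟨L, hL⟩ := exists_nat_gt (max R (d * R / ε) : ℝ)
  obtain ⟨hRL, hεL⟩ := max_lt_iff.1 hL
  have hL0 : (0 : ℝ) < L := R.cast_nonneg.trans_lt hRL
  refine ⟨L, by exact_mod_cast hL0, fun θ => ?_⟩
  obtain ⟨p, hp0, hpR, hpθ⟩ := hR θ
  refine ⟨p, hp0, hpθ, (card_cube_sdiff_vadd_le (by exact_mod_cast hL0)
    (by exact_mod_cast hRL.le) hpR).trans ?_⟩
  gcongr
  rw [div_le_iff₀ hL0, mul_comm ε]
  exact ((div_lt_iff₀ hε).1 hεL).le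

/-! ### Measures on product spaces -/

theorem iSup_measure_apply_of_monotone {X : Type*} [MeasurableSpace X] {ρ : ℕ → Measure X}
    (hρ : Monotone ρ) {B : Set X} (hB : MeasurableSet B) : (⨆ n, ρ n) B = ⨆ n, ρ n B := by
  have hmono (B : Set X) : Monotone fun n => ρ n B := fun _ _ h => hρ h B
  let ν : Measure X := Measure.ofMeasurable (fun B _ => ⨆ n, ρ n B) (by simp) fun f hf hd => by
    simp only [measure_iUnion hd hf, ENNReal.tsum_eq_iSup_sum]
    rw [iSup_comm]
    exact iSup_congr fun s => (ENNReal.finsetSum_iSup_of_monotone fun i => hmono (f i)).symm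
  have hν {B : Set X} (hB : MeasurableSet B) : ν B = ⨆ n, ρ n B := Measure.ofMeasurable_apply B hB
  have hle : ⨆ n, ρ n ≤ ν := iSup_le fun n => Measure.le_iff.2 fun s hs =>
    (le_iSup (fun n => ρ n s) n).trans_eq (hν hs).symm
  exact le_antisymm ((hle B).trans_eq (hν hB)) (iSup_le fun n => le_iSup ρ n B)

theorem measurePreserving_update_infinitePi {ι : Type*} [DecidableEq ι] {X : ι → Type*}
    [∀ i, MeasurableSpace (X i)] (μ : ∀ i, Measure (X i)) [∀ i, IsProbabilityMeasure (μ i)]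
    (n : ι) :
    MeasurePreserving (fun z : X n × (∀ i, X i) => Function.update z.2 n z.1)
      ((μ n).prod (Measure.infinitePi μ)) (Measure.infinitePi μ) := by
  have hmeas : Measurable fun z : X n × (∀ i, X i) => Function.update z.2 n z.1 :=
    measurable_pi_lambda _ fun i => by
      obtain rfl | hi := eq_or_ne i n
      · simpa using measurable_fst
      · simpa [hi] using measurable_snd.eval
  refine ⟨hmeas, Measure.eq_infinitePi μ fun I t ht => ?_⟩
  have hpre : (fun z : X n × (∀ i, X i) => Function.update z.2 n z.1) ⁻¹' Set.pi I t =
      {c | n ∈ I → c ∈ t n} ×ˢ Set.pi (I.erase n : Finset ι) t := by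
    ext ⟨c, y⟩
    simp only [Set.mem_preimage, Set.mem_pi, Finset.mem_coe, Finset.mem_erase, Set.mem_prod,
      Set.mem_ofPred_eq]
    refine ⟨fun h => ⟨fun hn => by simpa using h n hn,
      fun i hi => by simpa [hi.1] using h i hi.2⟩, fun h i hi => ?_⟩
    obtain rfl | hin := eq_or_ne i n
    · simpa using h.1 hi
    · simpa [hin] using h.2 i ⟨hin, hi⟩
  rw [Measure.map_apply hmeas (.pi I.countable_toSet fun i _ => ht i), hpre, Measure.prod_prod,
    Measure.infinitePi_pi μ fun i _ => ht i]
  by_cases hn : n ∈ I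
  · simpa [hn] using Finset.mul_prod_erase I (fun i => μ i (t i)) hn
  · simp [hn]

theorem exists_dependsOn_measure_symmDiff_lt {X : ℕ → Type*} [∀ n, MeasurableSpace (X n)]
    (ρ : Measure (∀ n, X n)) [IsFiniteMeasure ρ] {B : Set (∀ n, X n)} (hB : MeasurableSet B)
    {ε : ℝ≥0∞} (hε : 0 < ε) :
    ∃ (E : Set (∀ n, X n)) (j : ℕ), DependsOn (· ∈ E) (Set.Iic j) ∧ ρ (B ∆ E) < ε := by
  obtain ⟨E, hE, hlt⟩ := exists_measure_symmDiff_lt_of_generateFrom_isSetRing (μ := ρ)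
    isSetRing_measurableCylinders
    ⟨{Set.univ}, Set.countable_singleton _,
      Set.singleton_subset_iff.mpr (univ_mem_measurableCylinders X), by simp⟩
    generateFrom_measurableCylinders.symm hB hε
  rw [measurableCylinders_nat] at hE
  simp only [Set.mem_iUnion, Set.mem_singleton_iff, exists_prop] at hE
  obtain ⟨j, S, -, rfl⟩ := hE
  refine ⟨_, j, fun x y hxy => ?_, by rwa [symmDiff_comm]⟩
  have : (Finset.Iic j).restrict x = (Finset.Iic j).restrict y :=
    funext fun i => hxy i (Finset.mem_Iic.1 i.2)
  simp only [mem_cylinder, this]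

/-! ### Almost invariant sets -/

theorem measure_sdiff_vadd_le {G X : Type*} [AddGroup G] [AddAction G X] [MeasurableSpace X]
    (μ : Measure X) [VAddInvariantMeasure G X μ] (A B : Set X) (g : G) :
    μ (A \ (g +ᵥ A)) ≤ μ (A ∆ B) + μ (B \ (g +ᵥ B)) + μ (A ∆ B) := by
  have hsub : A \ (g +ᵥ A) ⊆ (A ∆ B) ∪ (B \ (g +ᵥ B)) ∪ (g +ᵥ A ∆ B) := by
    intro x hx
    simp only [Set.mem_union, Set.mem_symmDiff, Set.mem_sdiff,
      Set.mem_vadd_set_iff_neg_vadd_mem] at hx ⊢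
    tauto
  calc μ (A \ (g +ᵥ A)) ≤ μ (A ∆ B) + μ (B \ (g +ᵥ B)) + μ (g +ᵥ A ∆ B) :=
        (measure_mono hsub).trans
          ((measure_union_le _ _).trans (add_le_add_left (measure_union_le _ _) _))
    _ = _ := by rw [measure_vadd]

theorem tendsto_measure_inter_vadd {G X : Type*} [AddGroup G] [AddAction G X] [MeasurableSpace X]
    [MeasurableConstVAdd G X] (μ : Measure X) {A : Set X} (hA : MeasurableSet A) (hA' : μ A ≠ ⊤)
    {ι : Type*} {l : Filter ι} {γ : ι → G} (h : Tendsto (fun n => μ (A \ (γ n +ᵥ A))) l (𝓝 0)) :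
    Tendsto (fun n => μ (A ∩ (γ n +ᵥ A))) l (𝓝 (μ A)) := by
  have heq (n : ι) : μ (A ∩ (γ n +ᵥ A)) = μ A - μ (A \ (γ n +ᵥ A)) := by
    rw [← measure_inter_add_sdiff A (hA.const_vadd (γ n)),
      ENNReal.add_sub_cancel_right (measure_ne_top_of_subset Set.sdiff_subset hA')]
  simp only [heq]
  simpa using ENNReal.Tendsto.sub tendsto_const_nhds h (Or.inl hA')

/-! ### Cutting and stacking inside an odometer -/

/-- The data of Danilenko's `(C, F)`-construction, that is of cutting and stacking, for an action of
the group `G`: the `n`-th tower has shape `F n`; it is cut into pieces indexed by `C n`, and the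
piece with index `c` becomes the part `F n + c` of the tower of shape `F (n + 1)`. The subgroups
`H n` realise the construction inside of the odometer `∏ n, G ⧸ H n`. -/
structure CutAndStack (G : Type*) [AddCommGroup G] where
  H : ℕ → AddSubgroup G
  C : ℕ → Finset G
  F : ℕ → Finset G
  antitone_H : Antitone H
  nonempty_C : ∀ n, (C n).Nonempty
  mem_H_of_mem_C : ∀ {n c}, c ∈ C n → c ∈ H n
  zero_mem_F : ∀ n, 0 ∈ F n
  eq_of_sub_mem_H : ∀ {n f g}, f ∈ F n → g ∈ F n → f - g ∈ H n → f = g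
  add_add_mem_F : ∀ {n f g c}, f ∈ F n → g ∈ F n → c ∈ C n → f + g + c ∈ F (n + 1)
  eventually_mem_F : ∀ g, ∀ᶠ n in atTop, g ∈ F n

namespace CutAndStack

variable {G : Type*} [AddCommGroup G] (D : CutAndStack G)

/-- The odometer on which `G` acts. Its Haar measure plays no role: the construction yields an
invariant measure which is carried by the union of the towers. -/
abbrev Space : Type _ := ∀ n, G ⧸ D.H n

/-- The choices of a piece at each step of the construction. -/
abbrev Digits : Type _ := ∀ n, D.C n

instance (n : ℕ) : Nonempty (D.C n) := (D.nonempty_C n).to_subtype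

/-- The point of the odometer with the given digits from the `n`-th one on, and with the digit `0`
before. -/
def tail (n : ℕ) (y : D.Digits) : D.Space := fun j =>
  ((∑ k ∈ Finset.Ico n j, (y k : G) : G) : G ⧸ D.H j)

/-- The base of the `n`-th tower; its levels are the sets `f +ᵥ D.base n` for `f ∈ D.F n`. -/
def base (n : ℕ) : Set D.Space := Set.range (D.tail n)

/-- The `n`-th tower. -/
def tower (n : ℕ) : Set D.Space := (D.F n : Set G) +ᵥ D.base n

theorem vadd_apply (g : G) (x : D.Space) (j : ℕ) : (g +ᵥ x) j = g +ᵥ x j := rfl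

theorem tail_apply_of_le {n j : ℕ} (h : j ≤ n) (y : D.Digits) : D.tail n y j = 0 := by
  simp [tail, h]

theorem tail_eq_vadd_tail_succ (n : ℕ) (y : D.Digits) :
    D.tail n y = (y n : G) +ᵥ D.tail (n + 1) y := by
  funext j
  rw [vadd_apply]
  obtain hj | hj := le_or_gt j n
  · rw [tail_apply_of_le D hj, tail_apply_of_le D (hj.trans n.le_succ), eq_comm]
    change (((y n : G) + 0 : G) : G ⧸ D.H j) = 0
    rw [add_zero]
    exact (QuotientAddGroup.eq_zero_iff _).2 (D.antitone_H hj (D.mem_H_of_mem_C (y n).2))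
  · simp only [tail, Finset.sum_eq_sum_Ico_succ_bot hj]
    rfl

theorem tail_update_self (n : ℕ) (y : D.Digits) (c : D.C n) :
    D.tail n (Function.update y n c) = (c : G) +ᵥ D.tail (n + 1) y := by
  rw [tail_eq_vadd_tail_succ, Function.update_self]
  congr 1
  funext j
  refine congrArg _ (Finset.sum_congr rfl fun k hk => ?_)
  rw [Function.update_of_ne (Nat.ne_of_gt (Finset.mem_Ico.1 hk).1)]

theorem base_eq_vadd_base_succ (n : ℕ) : D.base n = (D.C n : Set G) +ᵥ D.base (n + 1) := by
  apply Set.Subset.antisymm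
  · rintro _ ⟨y, rfl⟩
    rw [tail_eq_vadd_tail_succ]
    exact Set.vadd_mem_vadd (y n).2 ⟨y, rfl⟩
  · rintro _ ⟨c, hc, _, ⟨y, rfl⟩, rfl⟩
    exact ⟨_, D.tail_update_self n y ⟨c, hc⟩⟩

theorem vadd_base_eq_vadd_base_succ [DecidableEq G] (K : Finset G) (n : ℕ) :
    (K : Set G) +ᵥ D.base n = ((K + D.C n : Finset G) : Set G) +ᵥ D.base (n + 1) := by
  rw [base_eq_vadd_base_succ, ← add_vadd, Finset.coe_add]

theorem vadd_base_sdiff_vadd_subset [DecidableEq G] (n : ℕ) (J : Finset G) (g : G) :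
    ((J : Set G) +ᵥ D.base n) \ (g +ᵥ ((J : Set G) +ᵥ D.base n)) ⊆
      ((J + D.C n \ (g +ᵥ D.C n) : Finset G) : Set G) +ᵥ D.base (n + 1) := by
  rw [vadd_base_eq_vadd_base_succ]
  rintro _ ⟨⟨_, hfc, y, hy, rfl⟩, hx⟩
  obtain ⟨f, hf, c, hc, rfl⟩ := Finset.mem_add.1 hfc
  refine Set.vadd_mem_vadd (Finset.add_mem_add hf (Finset.mem_sdiff.2 ⟨hc, fun hcg => hx ?_⟩)) hy
  obtain ⟨c', hc', rfl⟩ := Finset.mem_vadd_finset.1 hcg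
  refine ⟨_, Set.vadd_mem_vadd (Finset.add_mem_add hf hc') hy, ?_⟩
  simp only [vadd_eq_add, vadd_vadd]
  rw [add_left_comm]

theorem apply_of_mem_vadd_base {n j : ℕ} (hj : j ≤ n) {g : G} {x : D.Space}
    (hx : x ∈ g +ᵥ D.base n) : x j = g := by
  obtain ⟨_, ⟨y, rfl⟩, rfl⟩ := hx
  change g +ᵥ D.tail n y j = g
  rw [D.tail_apply_of_le hj]
  exact congrArg _ (add_zero g)

theorem inter_vadd_base_eq {j n : ℕ} (hjn : j ≤ n) {E : Set D.Space}
    (hE : DependsOn (· ∈ E) (Set.Iic j)) (K : Finset G) :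
    ∃ J ⊆ K, E ∩ ((K : Set G) +ᵥ D.base n) = (J : Set G) +ᵥ D.base n := by
  classical
  refine ⟨K.filter fun g => ((g +ᵥ D.base n) ∩ E).Nonempty, Finset.filter_subset _ _, ?_⟩
  ext x
  constructor
  · rintro ⟨hxE, g, hg, y, hy, rfl⟩
    exact Set.vadd_mem_vadd (Finset.mem_filter.2 ⟨hg, _, ⟨y, hy, rfl⟩, hxE⟩) hy
  · rintro ⟨g, hg, y, hy, rfl⟩
    obtain ⟨hgK, z, hz, hzE⟩ := Finset.mem_filter.1 hg
    refine ⟨?_, g, hgK, y, hy, rfl⟩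
    have h : ∀ i ∈ Set.Iic j, z i = (g +ᵥ y) i := fun i hi =>
      (D.apply_of_mem_vadd_base (hi.trans hjn) hz).trans
        (D.apply_of_mem_vadd_base (hi.trans hjn) ⟨y, hy, rfl⟩).symm
    exact (hE h).mp hzE

theorem eq_of_mem_vadd_base {n : ℕ} {f g : G} (hf : f ∈ D.F n) (hg : g ∈ D.F n) {x : D.Space}
    (hxf : x ∈ f +ᵥ D.base n) (hxg : x ∈ g +ᵥ D.base n) : f = g := by
  refine D.eq_of_sub_mem_H hf hg ?_
  rw [← QuotientAddGroup.eq_iff_sub_mem, ← D.apply_of_mem_vadd_base le_rfl hxf,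
    D.apply_of_mem_vadd_base le_rfl hxg]

theorem pairwiseDisjoint_vadd_base (n : ℕ) :
    (D.F n : Set G).PairwiseDisjoint (· +ᵥ D.base n) := fun _ hf _ hg hne =>
  Set.disjoint_left.2 fun _ hxf hxg => hne (D.eq_of_mem_vadd_base hf hg hxf hxg)

theorem add_injOn (n : ℕ) (g : G) :
    Set.InjOn (fun p : G × G => p.1 + p.2) ((g +ᵥ (D.F n : Set G)) ×ˢ (D.C n : Set G)) := by
  rintro ⟨_, c⟩ ⟨⟨f, hf, rfl⟩, hc⟩ ⟨_, c'⟩ ⟨⟨f', hf', rfl⟩, hc'⟩ h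
  simp only [vadd_eq_add, add_assoc, add_right_inj] at h
  have hsub : f - f' = c' - c := by rw [sub_eq_sub_iff_add_eq_add, h, add_comm]
  obtain rfl : f = f' := D.eq_of_sub_mem_H hf hf' <|
    hsub ▸ (D.H n).sub_mem (D.mem_H_of_mem_C hc') (D.mem_H_of_mem_C hc)
  rw [add_left_cancel h]

theorem card_add_C [DecidableEq G] {n : ℕ} {K : Finset G} (hK : K ⊆ D.F n) :
    (K + D.C n).card = K.card * (D.C n).card :=
  Finset.card_add_iff.2 <| (D.add_injOn n 0).mono <|
    Set.prod_mono (by rw [zero_vadd]; exact_mod_cast hK) subset_rfl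

theorem add_subset_F_succ [DecidableEq G] {n : ℕ} {g : G} (hg : g ∈ D.F n) {K : Finset G}
    (hK : K ⊆ D.F n) : (g +ᵥ K) + D.C n ⊆ D.F (n + 1) := by
  intro x hx
  obtain ⟨_, hgf, c, hc, rfl⟩ := Finset.mem_add.1 hx
  obtain ⟨f, hf, rfl⟩ := Finset.mem_vadd_finset.1 hgf
  exact D.add_add_mem_F hg (hK hf) hc

theorem add_C_subset_F_succ [DecidableEq G] {n : ℕ} {K : Finset G} (hK : K ⊆ D.F n) :
    K + D.C n ⊆ D.F (n + 1) := by
  simpa using D.add_subset_F_succ (D.zero_mem_F n) hK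

theorem tower_mono : Monotone D.tower := by
  classical
  refine monotone_nat_of_le_succ fun n => ?_
  rw [tower, vadd_base_eq_vadd_base_succ]
  exact Set.vadd_subset_vadd_right (by exact_mod_cast D.add_C_subset_F_succ subset_rfl)

theorem eq_zero_of_vadd_eq_self {g : G} {x : D.Space} (h : g +ᵥ x = x) : g = 0 := by
  obtain ⟨n, hn⟩ := (D.eventually_mem_F g).exists
  refine D.eq_of_sub_mem_H hn (D.zero_mem_F n) ?_
  obtain ⟨a, ha⟩ := QuotientAddGroup.mk_surjective (x n)
  have hga : ((g + a : G) : G ⧸ D.H n) = a := by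
    rw [ha, ← congrFun h n, vadd_apply, ← ha]
    rfl
  simpa [QuotientAddGroup.eq_iff_sub_mem] using hga

theorem tendsto_cofinite_of_mem_H {γ : ℕ → G} (hH : ∀ n, γ n ∈ D.H n) (hγ : ∀ n, γ n ≠ 0) :
    Tendsto γ atTop cofinite := by
  refine le_cofinite_iff_eventually_ne.2 fun g => eventually_map.2 ?_
  filter_upwards [D.eventually_mem_F g] with n hn hg
  exact hγ n (hg.trans (D.eq_of_sub_mem_H hn (D.zero_mem_F n) (by simpa [← hg] using hH n)))

/-! ### The invariant measure -/

/-- The measure of the base of the `n`-th tower, normalised such that the base of tower number `0`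
has measure `1`. -/
noncomputable def weight (n : ℕ) : ℝ≥0∞ := (∏ k ∈ Finset.range n, ((D.C k).card : ℝ≥0∞))⁻¹

theorem card_C_ne_zero (n : ℕ) : ((D.C n).card : ℝ≥0∞) ≠ 0 := by
  simpa using (D.nonempty_C n).ne_empty

theorem prod_card_C_ne_zero (n : ℕ) : ∏ k ∈ Finset.range n, ((D.C k).card : ℝ≥0∞) ≠ 0 :=
  Finset.prod_ne_zero_iff.2 fun k _ => D.card_C_ne_zero k

theorem weight_ne_top (n : ℕ) : D.weight n ≠ ⊤ :=
  ENNReal.inv_ne_top.2 (D.prod_card_C_ne_zero n)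

theorem weight_succ (n : ℕ) : D.weight (n + 1) = D.weight n * ((D.C n).card : ℝ≥0∞)⁻¹ := by
  rw [weight, weight, Finset.prod_range_succ,
    ENNReal.mul_inv (.inr (by simp)) (.inl (by simp [ENNReal.prod_ne_top]))]

theorem card_C_mul_weight_succ (n : ℕ) : (D.C n).card * D.weight (n + 1) = D.weight n := by
  rw [weight_succ, mul_left_comm, ENNReal.mul_inv_cancel (D.card_C_ne_zero n) (by simp), mul_one]

theorem exists_vadd_base_eq {k n : ℕ} (hkn : k ≤ n) {K : Finset G} (hK : K ⊆ D.F k) :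
    ∃ L ⊆ D.F n, (L : Set G) +ᵥ D.base n = (K : Set G) +ᵥ D.base k ∧
      L.card * D.weight n = K.card * D.weight k := by
  classical
  induction n, hkn using Nat.le_induction with
  | base => exact ⟨K, hK, rfl, rfl⟩
  | succ n _ ih =>
    obtain ⟨L, hL, hbase, hcard⟩ := ih
    refine ⟨L + D.C n, D.add_C_subset_F_succ hL, ?_, ?_⟩
    · rw [← hbase, ← vadd_base_eq_vadd_base_succ]
    · rw [← hcard, card_add_C D hL, Nat.cast_mul, mul_assoc, card_C_mul_weight_succ]

theorem continuous_tail [TopologicalSpace G] [ContinuousAdd G] (n : ℕ) :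
    Continuous (D.tail n) :=
  continuous_pi fun _ => continuous_quotient_mk'.comp <|
    continuous_finsetSum _ fun k _ => continuous_subtype_val.comp (continuous_apply k)

variable [MeasurableSpace G]

theorem measurable_tail [DiscreteMeasurableSpace G] [Countable G] (n : ℕ) : Measurable (D.tail n) :=
  measurable_pi_lambda _ fun _ => Measurable.of_discrete.comp <|
    Finset.measurable_sum _ fun k _ => measurable_subtype_coe.comp (measurable_pi_apply k)

/-- The law of a sequence of independent and uniformly distributed digits. -/
noncomputable def digitLaw : Measure D.Digits :=
  Measure.infinitePi fun k => uniformOn (Set.univ : Set (D.C k))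

/-- The part of the invariant measure which is carried by the base of the `n`-th tower. -/
noncomputable def baseMeasure (n : ℕ) : Measure D.Space :=
  D.weight n • D.digitLaw.map (D.tail n)

/-- The part of the invariant measure which is carried by the union of the translates of the base
of the `n`-th tower by the elements of `K`, provided that these are disjoint. -/
noncomputable def partialMeasure (n : ℕ) (K : Finset G) : Measure D.Space :=
  ∑ g ∈ K, (D.baseMeasure n).map (g +ᵥ ·)

theorem partialMeasure_mono (n : ℕ) : Monotone (D.partialMeasure n) := fun _ _ h =>
  Measure.le_iff'.2 fun B => by
    simp only [partialMeasure, Measure.finsetSum_apply]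
    exact Finset.sum_le_sum_of_subset h

/-- The part of the invariant measure which is carried by the `n`-th tower. -/
noncomputable def stageMeasure (n : ℕ) : Measure D.Space := D.partialMeasure n (D.F n)

/-- The invariant measure, as the increasing limit of the measures on the towers. -/
noncomputable def measure : Measure D.Space := ⨆ n, D.stageMeasure n

variable [DiscreteMeasurableSpace G]

instance (n : ℕ) : IsProbabilityMeasure (uniformOn (Set.univ : Set (D.C n))) :=
  isProbabilityMeasure_uniformOn Set.finite_univ Set.univ_nonempty

instance : IsProbabilityMeasure D.digitLaw := by
  unfold digitLaw
  infer_instance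

instance : MeasurableConstVAdd G D.Space :=
  ⟨fun _ => measurable_pi_lambda _ fun j => Measurable.of_discrete.comp (measurable_pi_apply j)⟩

theorem map_vadd_partialMeasure [DecidableEq G] (n : ℕ) (g : G) (K : Finset G) :
    (D.partialMeasure n K).map (g +ᵥ ·) = D.partialMeasure n (g +ᵥ K) := by
  rw [partialMeasure, partialMeasure, ← Measure.mapₗ_apply_of_measurable (measurable_const_vadd g),
    map_sum, ← Finset.image_vadd, Finset.sum_image (AddAction.injective g).injOn]
  refine Finset.sum_congr rfl fun f _ => ?_
  rw [Measure.mapₗ_apply_of_measurable (measurable_const_vadd g),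
    Measure.map_map (measurable_const_vadd g) (measurable_const_vadd f)]
  congr 1
  exact funext fun x => vadd_vadd g f x

variable [Countable G]

theorem measurableSet_base (n : ℕ) : MeasurableSet (D.base n) := by
  let : TopologicalSpace G := ⊥
  have : DiscreteTopology G := ⟨rfl⟩
  exact (isCompact_range (D.continuous_tail n)).measurableSet

theorem measurableSet_vadd_base (K : Set G) (n : ℕ) : MeasurableSet (K +ᵥ D.base n) := by
  rw [← Set.iUnion_vadd_set]
  exact .biUnion K.to_countable fun g _ => (D.measurableSet_base n).const_vadd g

instance : StandardBorelSpace D.Space :=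
  have (n : ℕ) : Countable (G ⧸ D.H n) := Quotient.countable
  inferInstance

theorem baseMeasure_eq_partialMeasure_succ (n : ℕ) :
    D.baseMeasure n = D.partialMeasure (n + 1) (D.C n) := by
  have hpres := measurePreserving_update_infinitePi
    (fun k => uniformOn (Set.univ : Set (D.C k))) n
  have hsum (B : Set D.Space) (hB : MeasurableSet B) : D.digitLaw.map (D.tail n) B =
      ∑ c ∈ D.C n, D.digitLaw (D.tail (n + 1) ⁻¹' ((c +ᵥ ·) ⁻¹' B)) *
        ((D.C n).card : ℝ≥0∞)⁻¹ := by
    have htail := D.measurable_tail n hB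
    rw [Measure.map_apply (D.measurable_tail n) hB, digitLaw, ← hpres.measure_preimage
      htail.nullMeasurableSet, Measure.prod_apply (hpres.measurable htail), lintegral_fintype,
      ← Finset.sum_coe_sort (D.C n)]
    refine Finset.sum_congr rfl fun c _ => ?_
    rw [uniformOn_univ]
    congr 1
    · congr 1
      ext y
      simp [tail_update_self]
    · simp
  ext B hB
  rw [baseMeasure, Measure.smul_apply, hsum B hB, partialMeasure, Measure.finsetSum_apply,
    smul_eq_mul, Finset.mul_sum]
  refine Finset.sum_congr rfl fun c _ => ?_
  have hc := measurable_const_vadd (α := D.Space) c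
  rw [baseMeasure, weight_succ, Measure.map_apply hc hB, Measure.smul_apply,
    Measure.map_apply (D.measurable_tail _) (hc hB), smul_eq_mul]
  ring

theorem partialMeasure_eq_partialMeasure_succ [DecidableEq G] {n : ℕ} {g : G} {K : Finset G}
    (hK : K ⊆ g +ᵥ D.F n) : D.partialMeasure n K = D.partialMeasure (n + 1) (K + D.C n) := by
  have hinj : Set.InjOn (fun p : G × G => p.1 + p.2) (K ×ˢ D.C n : Finset (G × G)) :=
    (D.add_injOn n g).mono <| by
      rw [Finset.coe_product]
      exact Set.prod_mono (by exact_mod_cast hK) subset_rfl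
  rw [partialMeasure, partialMeasure, ← Finset.image_add_product, Finset.sum_image hinj,
    Finset.sum_product]
  refine Finset.sum_congr rfl fun f _ => ?_
  rw [baseMeasure_eq_partialMeasure_succ, map_vadd_partialMeasure, partialMeasure,
    ← Finset.image_vadd, Finset.sum_image (AddAction.injective f).injOn]
  rfl

theorem map_vadd_stageMeasure_le {n : ℕ} {g : G} (hg : g ∈ D.F n) :
    (D.stageMeasure n).map (g +ᵥ ·) ≤ D.stageMeasure (n + 1) := by
  classical
  rw [stageMeasure, map_vadd_partialMeasure, D.partialMeasure_eq_partialMeasure_succ subset_rfl]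
  exact D.partialMeasure_mono _ (D.add_subset_F_succ hg subset_rfl)

theorem stageMeasure_mono : Monotone D.stageMeasure := monotone_nat_of_le_succ fun n => by
  simpa using D.map_vadd_stageMeasure_le (D.zero_mem_F n)

theorem measure_apply {B : Set D.Space} (hB : MeasurableSet B) :
    D.measure B = ⨆ n, D.stageMeasure n B :=
  iSup_measure_apply_of_monotone D.stageMeasure_mono hB

theorem map_vadd_measure_le (g : G) : D.measure.map (g +ᵥ ·) ≤ D.measure := by
  refine Measure.le_iff.2 fun B hB => ?_
  have hg := measurable_const_vadd (α := D.Space) g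
  rw [Measure.map_apply hg hB, D.measure_apply (hg hB)]
  refine iSup_le fun n => ?_
  obtain ⟨N, hN, hnN⟩ := ((D.eventually_mem_F g).and (eventually_ge_atTop n)).exists
  calc D.stageMeasure n ((g +ᵥ ·) ⁻¹' B)
      ≤ D.stageMeasure N ((g +ᵥ ·) ⁻¹' B) := D.stageMeasure_mono hnN _
    _ = (D.stageMeasure N).map (g +ᵥ ·) B := (Measure.map_apply hg hB).symm
    _ ≤ D.stageMeasure (N + 1) B := D.map_vadd_stageMeasure_le hN B
    _ ≤ D.measure B := le_iSup D.stageMeasure (N + 1) B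

instance : VAddInvariantMeasure G D.Space D.measure := by
  have hle (g : G) {B : Set D.Space} (hB : MeasurableSet B) :
      D.measure ((g +ᵥ ·) ⁻¹' B) ≤ D.measure B :=
    (Measure.map_apply (measurable_const_vadd g) hB).symm.trans_le (D.map_vadd_measure_le g B)
  refine ⟨fun g B hB => le_antisymm (hle g hB) ?_⟩
  simpa [← Set.preimage_comp, Function.comp_def] using hle (-g) (measurable_const_vadd g hB)

theorem baseMeasure_of_base_subset {n : ℕ} {B : Set D.Space} (hB : MeasurableSet B)
    (h : D.base n ⊆ B) : D.baseMeasure n B = D.weight n := by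
  have huniv : D.tail n ⁻¹' B = Set.univ := Set.eq_univ_of_forall fun y => h ⟨y, rfl⟩
  rw [baseMeasure, Measure.smul_apply, Measure.map_apply (D.measurable_tail n) hB, huniv,
    measure_univ, smul_eq_mul, mul_one]

theorem baseMeasure_of_disjoint_base {n : ℕ} {B : Set D.Space} (hB : MeasurableSet B)
    (h : Disjoint (D.base n) B) : D.baseMeasure n B = 0 := by
  have hempty : D.tail n ⁻¹' B = ∅ :=
    Set.eq_empty_of_forall_notMem fun y => Set.disjoint_left.1 h ⟨y, rfl⟩
  rw [baseMeasure, Measure.smul_apply, Measure.map_apply (D.measurable_tail n) hB, hempty,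
    measure_empty, smul_zero]

theorem stageMeasure_vadd_base {n : ℕ} {K : Finset G} (hK : K ⊆ D.F n) :
    D.stageMeasure n ((K : Set G) +ᵥ D.base n) = K.card * D.weight n := by
  classical
  have hmeas := D.measurableSet_vadd_base K n
  have hlevel (g : G) (hg : g ∈ D.F n) :
      (D.baseMeasure n).map (g +ᵥ ·) ((K : Set G) +ᵥ D.base n) =
        if g ∈ K then D.weight n else 0 := by
    rw [Measure.map_apply (measurable_const_vadd g) hmeas]
    split_ifs with hgK
    · exact D.baseMeasure_of_base_subset (measurable_const_vadd g hmeas) fun x hx =>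
        Set.vadd_mem_vadd hgK hx
    · refine D.baseMeasure_of_disjoint_base (measurable_const_vadd g hmeas) ?_
      rw [Set.disjoint_left]
      rintro x hx ⟨f, hf, y, hy, hfy⟩
      exact hgK (D.eq_of_mem_vadd_base hg (hK hf) ⟨x, hx, rfl⟩ ⟨y, hy, hfy⟩ ▸ hf)
  rw [stageMeasure, partialMeasure, Measure.finsetSum_apply, Finset.sum_congr rfl hlevel,
    Finset.sum_ite_mem, Finset.inter_eq_right.2 hK, Finset.sum_const, nsmul_eq_mul]

theorem measure_vadd_base {n : ℕ} {K : Finset G} (hK : K ⊆ D.F n) :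
    D.measure ((K : Set G) +ᵥ D.base n) = K.card * D.weight n := by
  rw [D.measure_apply (D.measurableSet_vadd_base K n)]
  refine le_antisymm (iSup_le fun k => ?_) ?_
  · obtain ⟨L, hL, hLK, hcard⟩ := D.exists_vadd_base_eq (le_max_right k n) hK
    rw [← hcard, ← D.stageMeasure_vadd_base hL, hLK]
    exact D.stageMeasure_mono (le_max_left k n) _
  · rw [← D.stageMeasure_vadd_base hK]
    exact le_iSup (fun k => D.stageMeasure k ((K : Set G) +ᵥ D.base n)) n

theorem measure_base (n : ℕ) : D.measure (D.base n) = D.weight n := by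
  simpa using D.measure_vadd_base (Finset.singleton_subset_iff.2 (D.zero_mem_F n))

theorem measure_vadd_base_le (n : ℕ) (K : Finset G) :
    D.measure ((K : Set G) +ᵥ D.base n) ≤ K.card * D.weight n := by
  rw [← Set.iUnion_vadd_set]
  refine (measure_biUnion_finset_le K _).trans_eq ?_
  simp only [measure_vadd, measure_base, Finset.sum_const, nsmul_eq_mul]

theorem measurableSet_tower (n : ℕ) : MeasurableSet (D.tower n) :=
  D.measurableSet_vadd_base _ n

theorem measure_tower_ne_top (n : ℕ) : D.measure (D.tower n) ≠ ⊤ :=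
  (D.measure_vadd_base subset_rfl).trans_ne (ENNReal.mul_ne_top (by simp) (D.weight_ne_top n))

theorem measure_compl_iUnion_tower : D.measure (⋃ n, D.tower n)ᶜ = 0 := by
  have hm : MeasurableSet (⋃ n, D.tower n)ᶜ := (MeasurableSet.iUnion D.measurableSet_tower).compl
  rw [D.measure_apply hm, ENNReal.iSup_eq_zero]
  intro n
  rw [stageMeasure, partialMeasure, Measure.finsetSum_apply]
  refine Finset.sum_eq_zero fun g hg => ?_
  rw [Measure.map_apply (measurable_const_vadd g) hm]
  refine D.baseMeasure_of_disjoint_base (measurable_const_vadd g hm) ?_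
  exact Set.disjoint_left.2 fun x hx hgx =>
    hgx (Set.mem_iUnion_of_mem n (Set.vadd_mem_vadd hg hx))

instance : SigmaFinite D.measure := by
  refine ⟨⟨⟨fun n => D.tower n ∪ (⋃ n, D.tower n)ᶜ, fun _ => trivial, fun n => ?_, ?_⟩⟩⟩
  · refine (measure_union_le _ _).trans_lt ?_
    rw [measure_compl_iUnion_tower, add_zero]
    exact (D.measure_tower_ne_top n).lt_top
  · rw [← Set.iUnion_union, Set.union_compl_self]

theorem measure_univ_eq_top
    (h : ∀ q : ℕ, ∃ n, q * ∏ k ∈ Finset.range n, (D.C k).card ≤ (D.F n).card) :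
    D.measure Set.univ = ⊤ := by
  refine ENNReal.eq_top_of_forall_nnreal_le fun r => ?_
  obtain ⟨q, hq⟩ := exists_nat_ge r
  obtain ⟨n, hn⟩ := h q
  calc (r : ℝ≥0∞) ≤ q := by exact_mod_cast hq
    _ = q * (∏ k ∈ Finset.range n, ((D.C k).card : ℝ≥0∞)) * D.weight n := by
        rw [weight, mul_assoc, ENNReal.mul_inv_cancel (D.prod_card_C_ne_zero n)
          (ENNReal.prod_ne_top fun k _ => by simp), mul_one]
    _ ≤ (D.F n).card * D.weight n := by
        gcongr
        exact_mod_cast hn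
    _ = D.measure (D.tower n) := (D.measure_vadd_base subset_rfl).symm
    _ ≤ _ := measure_mono (Set.subset_univ _)

/-! ### Approximation by unions of levels -/

theorem tendsto_measure_sdiff_tower {B : Set D.Space} (hB : MeasurableSet B)
    (hB' : D.measure B ≠ ⊤) : Tendsto (fun k => D.measure (B \ D.tower k)) atTop (𝓝 0) := by
  have hnull : D.measure (⋂ k, B \ D.tower k) = 0 := by
    refine measure_mono_null ?_ D.measure_compl_iUnion_tower
    rw [Set.compl_iUnion]
    exact Set.iInter_mono fun _ => Set.sdiff_subset_compl _ _
  rw [← hnull]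
  exact tendsto_measure_iInter_atTop
    (fun k => (hB.diff (D.measurableSet_tower k)).nullMeasurableSet)
    (fun _ _ h => Set.sdiff_subset_sdiff_right (D.tower_mono h))
    ⟨0, measure_ne_top_of_subset Set.sdiff_subset hB'⟩

theorem eventually_exists_measure_symmDiff_lt {B : Set D.Space} (hB : MeasurableSet B)
    (hB' : D.measure B ≠ ⊤) {ε : ℝ≥0∞} (hε : 0 < ε) :
    ∀ᶠ n in atTop, ∃ J ⊆ D.F n, D.measure (B ∆ ((J : Set G) +ᵥ D.base n)) < ε := by
  have hε2 : 0 < ε / 2 := ENNReal.half_pos hε.ne'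
  obtain ⟨k, hk⟩ :=
    ((D.tendsto_measure_sdiff_tower hB hB').eventually_lt_const hε2).exists
  have : IsFiniteMeasure (D.measure.restrict (D.tower k)) :=
    isFiniteMeasure_restrict.2 (D.measure_tower_ne_top k)
  obtain ⟨E, j, hE, hBE⟩ :=
    exists_dependsOn_measure_symmDiff_lt (D.measure.restrict (D.tower k)) hB hε2
  filter_upwards [eventually_ge_atTop (max k j)] with n hn
  obtain ⟨K, hK, hKk, -⟩ := D.exists_vadd_base_eq ((le_max_left k j).trans hn) (subset_refl (D.F k))
  obtain ⟨J, hJK, hJ⟩ := D.inter_vadd_base_eq ((le_max_right k j).trans hn) hE K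
  refine ⟨J, hJK.trans hK, ?_⟩
  rw [← hJ, hKk, ← tower]
  calc D.measure (B ∆ (E ∩ D.tower k))
      ≤ D.measure (B \ D.tower k ∪ (B ∆ E) ∩ D.tower k) := measure_mono fun x hx => by
        simp only [Set.mem_union, Set.mem_symmDiff, Set.mem_sdiff, Set.mem_inter_iff] at hx ⊢
        tauto
    _ ≤ D.measure (B \ D.tower k) + D.measure.restrict (D.tower k) (B ∆ E) := by
        rw [Measure.restrict_apply' (D.measurableSet_tower k)]
        exact measure_union_le _ _
    _ < ε / 2 + ε / 2 := ENNReal.add_lt_add hk hBE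
    _ = ε := ENNReal.add_halves ε

/-! ### Rigidity -/

theorem measure_vadd_base_sdiff_vadd_le [DecidableEq G] {n : ℕ} {J : Finset G} (hJ : J ⊆ D.F n)
    {g : G} {δ : ℝ≥0∞} (hg : ((D.C n \ (g +ᵥ D.C n)).card : ℝ≥0∞) ≤ δ * (D.C n).card) :
    D.measure (((J : Set G) +ᵥ D.base n) \ (g +ᵥ ((J : Set G) +ᵥ D.base n))) ≤
      δ * D.measure ((J : Set G) +ᵥ D.base n) := by
  calc D.measure (((J : Set G) +ᵥ D.base n) \ (g +ᵥ ((J : Set G) +ᵥ D.base n)))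
      ≤ (J + D.C n \ (g +ᵥ D.C n)).card * D.weight (n + 1) :=
        (measure_mono (D.vadd_base_sdiff_vadd_subset n J g)).trans (D.measure_vadd_base_le _ _)
    _ ≤ J.card * (δ * (D.C n).card) * D.weight (n + 1) := by
        gcongr
        refine le_trans ?_ (mul_le_mul_right hg _)
        exact_mod_cast Finset.card_add_le
    _ = δ * (J.card * ((D.C n).card * D.weight (n + 1))) := by ring
    _ = δ * D.measure ((J : Set G) +ᵥ D.base n) := by
        rw [card_C_mul_weight_succ, D.measure_vadd_base hJ]

theorem tendsto_measure_sdiff_vadd [DecidableEq G] {γ : ℕ → G} {δ : ℕ → ℝ≥0∞}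
    (hδ : Tendsto δ atTop (𝓝 0))
    (hγ : ∀ n, ((D.C n \ (γ n +ᵥ D.C n)).card : ℝ≥0∞) ≤ δ n * (D.C n).card)
    {A : Set D.Space} (hA : MeasurableSet A) (hA' : D.measure A ≠ ⊤) :
    Tendsto (fun n => D.measure (A \ (γ n +ᵥ A))) atTop (𝓝 0) := by
  refine ENNReal.tendsto_nhds_zero.2 fun ε hε => ?_
  obtain rfl | hε' := eq_or_ne ε ⊤
  · simp
  have hε3 : 0 < ε / 3 := ENNReal.div_pos hε.ne' (by simp)
  have hlim : Tendsto (fun n => δ n * (D.measure A + ε / 3)) atTop (𝓝 0) := by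
    simpa using ENNReal.Tendsto.mul_const hδ (b := D.measure A + ε / 3)
      (.inr (ENNReal.add_ne_top.2 ⟨hA', ENNReal.div_ne_top hε' (by simp)⟩))
  filter_upwards [D.eventually_exists_measure_symmDiff_lt hA hA' hε3,
    hlim.eventually_lt_const hε3] with n ⟨J, hJ, hAJ⟩ hn
  calc D.measure (A \ (γ n +ᵥ A)) ≤ ε / 3 + ε / 3 + ε / 3 := by
        refine (measure_sdiff_vadd_le D.measure A ((J : Set G) +ᵥ D.base n) (γ n)).trans ?_
        gcongr
        refine (D.measure_vadd_base_sdiff_vadd_le hJ (hγ n)).trans (le_trans ?_ hn.le)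
        gcongr
        rw [symmDiff_comm] at hAJ
        exact (tsub_le_iff_left.1 le_measure_symmDiff).trans (by gcongr)
    _ = ε := ENNReal.add_thirds ε

end CutAndStack

/-! ### Dynamics of `ℤ^d`-actions -/

theorem translateSet_eq_vadd {d : ℕ} {X : Type*} [AddAction (Fin d → ℤ) X] (γ : Fin d → ℤ)
    (A : Set X) : translateSet γ A = γ +ᵥ A := rfl

theorem IsRigidAlong.isRecurrentAlong {d : ℕ} {X : Type*} [MeasurableSpace X]
    [AddAction (Fin d → ℤ) X] {μ : Measure X} [SigmaFinite μ] {θ : Directions d}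
    (h : IsRigidAlong μ θ) : IsRecurrentAlong μ θ := by
  obtain ⟨γ, hγ, hdist, hrig⟩ := h
  intro ε hε A hA hA0
  obtain ⟨B, hB, hBA, hB0, hBtop⟩ := μ.exists_subset_measure_lt_top hA hA0
  obtain ⟨n, hn, hdistn, hrign⟩ := ((hγ.eventually (eventually_cofinite_ne 0)).and
    ((hdist.eventually_lt_const hε).and ((hrig B hB hBtop).eventually_const_lt hB0))).exists
  obtain ⟨g, hg, hlt⟩ := (Metric.infDist_lt_iff ⟨0, θ.submodule.zero_mem⟩).1 hdistn
  exact ⟨γ n, hn, ⟨g, hg, hlt⟩, hrign.trans_le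
    (measure_mono (Set.inter_subset_inter hBA (Set.image_mono hBA)))⟩

theorem rigidDirections_subset_recurrentDirections {d : ℕ} {X : Type*} [MeasurableSpace X]
    [AddAction (Fin d → ℤ) X] (μ : Measure X) [SigmaFinite μ] :
    rigidDirections d μ ⊆ recurrentDirections d μ := fun _ => IsRigidAlong.isRecurrentAlong

namespace CutAndStack

variable {d : ℕ} (D : CutAndStack (Fin d → ℤ))

theorem isFreeAction : IsFreeAction d D.Space := fun _ _ => D.eq_zero_of_vadd_eq_self

theorem isRankOne {h : ℕ → ℕ} {e : ℕ → Fin d → ℤ} (hF : ∀ n, cube d (h n) = e n +ᵥ D.F n) :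
    IsRankOne d D.measure := by
  have hlevel (n : ℕ) (f : Fin d → ℤ) :
      translateSet (e n +ᵥ f) (-e n +ᵥ D.base n) = f +ᵥ D.base n := by
    rw [translateSet_eq_vadd, vadd_vadd, vadd_eq_add, add_neg_cancel_comm]
  refine ⟨fun n => -e n +ᵥ D.base n, h, fun n => ⟨(D.measurableSet_base n).const_vadd _, ?_⟩,
    fun n => ?_, fun B hB hB' ε hε => ?_⟩
  · rw [measure_vadd, measure_base]
    exact (D.weight_ne_top n).lt_top
  · rw [hF, Finset.coe_vadd_finset]
    rintro _ ⟨f, hf, rfl⟩ _ ⟨g, hg, rfl⟩ hne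
    simp only [Function.onFun, hlevel]
    exact D.pairwiseDisjoint_vadd_base n hf hg (ne_of_apply_ne _ hne)
  · filter_upwards [D.eventually_exists_measure_symmDiff_lt hB hB'.ne hε] with n ⟨J, hJ, hlt⟩
    refine ⟨e n +ᵥ J, (hF n).symm ▸ Finset.vadd_finset_subset_vadd_finset hJ, ?_⟩
    rw [← Set.iUnion_vadd_set] at hlt
    rw [← Finset.image_vadd, Finset.set_biUnion_finset_image]
    simpa only [hlevel, Finset.mem_coe] using hlt

theorem isRigidAlong {θ : Directions d} {γ : ℕ → Fin d → ℤ} (hH : ∀ n, γ n ∈ D.H n)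
    (hγ : ∀ n, γ n ≠ 0)
    (hθ : Tendsto (fun n => Metric.infDist (latticePoint (γ n)) θ.submodule) atTop (𝓝 0))
    {δ : ℕ → ℝ≥0∞} (hδ : Tendsto δ atTop (𝓝 0))
    (hC : ∀ n, ((D.C n \ (γ n +ᵥ D.C n)).card : ℝ≥0∞) ≤ δ n * (D.C n).card) :
    IsRigidAlong D.measure θ :=
  ⟨γ, D.tendsto_cofinite_of_mem_H hH hγ, hθ, fun _ hA hA' =>
    tendsto_measure_inter_vadd _ hA hA'.ne (D.tendsto_measure_sdiff_vadd hδ hC hA hA'.ne)⟩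

end CutAndStack

/-! ### Cubic towers -/

/-- The cube `{-r, …, r}^d` in `ℤ^d`. -/
noncomputable def centeredCube (d r : ℕ) : Finset (Fin d → ℤ) :=
  Fintype.piFinset fun _ => Finset.Icc (-r : ℤ) r

theorem mem_centeredCube {d r : ℕ} {f : Fin d → ℤ} :
    f ∈ centeredCube d r ↔ ∀ i, -(r : ℤ) ≤ f i ∧ f i ≤ r := by
  simp [centeredCube]

theorem card_centeredCube (d r : ℕ) : (centeredCube d r).card = (2 * r + 1) ^ d := by
  have h : ((r : ℤ) + 1 + r).toNat = 2 * r + 1 := by omega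
  simp [centeredCube, h]

theorem cube_eq_vadd_centeredCube (d r : ℕ) :
    cube d (2 * r + 1) = ((fun _ => (r : ℤ)) : Fin d → ℤ) +ᵥ centeredCube d r := by
  ext f
  rw [← Finset.neg_vadd_mem_iff, mem_cube, mem_centeredCube]
  refine forall_congr' fun i => ?_
  simp only [vadd_eq_add, Pi.add_apply, Pi.neg_apply]
  omega

theorem eventually_mem_centeredCube {d : ℕ} {r : ℕ → ℕ} (hr : Tendsto r atTop atTop)
    (f : Fin d → ℤ) : ∀ᶠ n in atTop, f ∈ centeredCube d (r n) := by
  simp only [mem_centeredCube]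
  refine eventually_all.2 fun i => ?_
  filter_upwards [hr.eventually_ge_atTop (f i).natAbs] with n hn
  omega

theorem eq_of_dvd_sub_of_mem_centeredCube {d m : ℕ} (hm : 0 < m) {f g : Fin d → ℤ}
    (hf : f ∈ centeredCube d (m / 3)) (hg : g ∈ centeredCube d (m / 3))
    (h : ∀ i, (m : ℤ) ∣ (f - g) i) : f = g := by
  funext i
  have hfi := mem_centeredCube.1 hf i
  have hgi := mem_centeredCube.1 hg i
  exact sub_eq_zero.1 (Int.eq_zero_of_abs_lt_dvd (h i) (by rw [abs_lt]; omega))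

theorem add_add_nsmul_mem_centeredCube {d m L : ℕ} {f g t : Fin d → ℤ}
    (hf : f ∈ centeredCube d (m / 3)) (hg : g ∈ centeredCube d (m / 3)) (ht : t ∈ cube d L) :
    f + g + m • t ∈ centeredCube d (m * L) := by
  refine mem_centeredCube.2 fun i => ?_
  have hfi := mem_centeredCube.1 hf i
  have hgi := mem_centeredCube.1 hg i
  obtain ⟨ht0, htL⟩ := mem_cube.1 ht i
  have hmt : (m : ℤ) * (t i + 1) ≤ m * L := by
    gcongr
    omega
  have hmt0 : 0 ≤ (m : ℤ) * t i := by positivity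
  have hadd : (f + g + m • t) i = f i + g i + m * t i := by simp
  rw [mul_add_one] at hmt
  rw [hadd]
  push_cast at hfi hgi ⊢
  omega

/-- The translates of the `n`-th tower are placed along the lattice `modulus l n • ℤ^d`, if the side
lengths of the cubes of copies are `l 0, l 1, …`. The tower itself is a cube whose side length is
about two thirds of `modulus l n`; the remaining space makes the measure infinite. -/
def modulus (l : ℕ → ℕ) (n : ℕ) : ℕ := ∏ k ∈ Finset.range n, 3 * l k

section Modulus

variable {l : ℕ → ℕ}

theorem modulus_succ_div_three (n : ℕ) : modulus l (n + 1) / 3 = modulus l n * l n := by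
  rw [modulus, Finset.prod_range_succ, ← modulus, Nat.mul_left_comm,
    Nat.mul_div_cancel_left _ three_pos]

theorem modulus_eq_pow_mul_prod (n : ℕ) : modulus l n = 3 ^ n * ∏ k ∈ Finset.range n, l k := by
  simp [modulus, Finset.prod_mul_distrib]

theorem pow_le_modulus (hl : ∀ n, 0 < l n) (n : ℕ) : 3 ^ n ≤ modulus l n := by
  rw [modulus_eq_pow_mul_prod]
  exact Nat.le_mul_of_pos_right _ (Finset.prod_pos fun k _ => hl k)

theorem modulus_pos (hl : ∀ n, 0 < l n) (n : ℕ) : 0 < modulus l n :=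
  Finset.prod_pos fun k _ => Nat.mul_pos three_pos (hl k)

theorem modulus_dvd_modulus {k n : ℕ} (h : k ≤ n) : modulus l k ∣ modulus l n :=
  Finset.prod_dvd_prod_of_subset _ _ _ (Finset.range_mono h)

theorem tendsto_modulus_div_three (hl : ∀ n, 0 < l n) :
    Tendsto (fun n => modulus l n / 3) atTop atTop := by
  have hpow : Tendsto (fun n => 3 ^ n) atTop (atTop : Filter ℕ) :=
    tendsto_pow_atTop_atTop_of_one_lt (by norm_num)
  exact (Nat.tendsto_div_const_atTop three_ne_zero).comp
    (tendsto_atTop_mono (pow_le_modulus hl) hpow)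

theorem exists_forall_modulus {P : ℕ → ℕ → ℕ → Prop} (hP : ∀ n m, ∃ L, P n m L) :
    ∃ l : ℕ → ℕ, ∀ n, P n (modulus l n) (l n) := by
  choose L hL using hP
  let m : ℕ → ℕ := fun n => Nat.rec 1 (fun k mk => mk * (3 * L k mk)) n
  have hm (n : ℕ) : modulus (fun k => L k (m k)) n = m n := by
    induction n with
    | zero => rfl
    | succ n ih => rw [modulus, Finset.prod_range_succ, ← modulus, ih]
  exact ⟨fun k => L k (m k), fun n => by rw [hm]; exact hL n (m n)⟩

end Modulus

/-- Cutting and stacking with cubic towers: `l n ^ d` copies of the `n`-th tower are arranged as a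
cube of side length `l n` in the lattice `modulus l n • ℤ^d`. -/
noncomputable def cubicTowers (d : ℕ) {l : ℕ → ℕ} (hl : ∀ n, 0 < l n) :
    CutAndStack (Fin d → ℤ) where
  H n := AddSubgroup.pi Set.univ fun _ => AddSubgroup.zmultiples (modulus l n : ℤ)
  C n := (cube d (l n)).image (modulus l n • ·)
  F n := centeredCube d (modulus l n / 3)
  antitone_H _ _ h _ hx i hi := Int.mem_zmultiples_iff.2 <|
    (Int.natCast_dvd_natCast.2 (modulus_dvd_modulus h)).trans (Int.mem_zmultiples_iff.1 (hx i hi))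
  nonempty_C n := Finset.Nonempty.image
    ⟨0, mem_cube.2 fun _ => ⟨le_rfl, Int.natCast_pos.2 (hl n)⟩⟩ _
  mem_H_of_mem_C hc i _ := by
    obtain ⟨t, -, rfl⟩ := Finset.mem_image.1 hc
    exact Int.mem_zmultiples_iff.2 ⟨t i, by simp⟩
  zero_mem_F n := mem_centeredCube.2 fun _ => ⟨by simp; omega, by positivity⟩
  eq_of_sub_mem_H hf hg h := eq_of_dvd_sub_of_mem_centeredCube (modulus_pos hl _) hf hg fun i =>
    Int.mem_zmultiples_iff.1 (h i trivial)
  add_add_mem_F {n _ _ c} hf hg hc := by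
    obtain ⟨t, ht, rfl⟩ := Finset.mem_image.1 hc
    rw [modulus_succ_div_three]
    exact add_add_nsmul_mem_centeredCube hf hg ht
  eventually_mem_F := eventually_mem_centeredCube (tendsto_modulus_div_three hl)

section CubicTowers

variable {d : ℕ} {l : ℕ → ℕ} (hl : ∀ n, 0 < l n)

theorem isRankOne_cubicTowers : IsRankOne d (cubicTowers d hl).measure :=
  (cubicTowers d hl).isRankOne fun n => cube_eq_vadd_centeredCube d (modulus l n / 3)

theorem card_C_cubicTowers (n : ℕ) : ((cubicTowers d hl).C n).card = l n ^ d :=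
  (Finset.card_image_of_injective _ (nsmul_right_injective (modulus_pos hl n).ne')).trans
    (card_cube _ _)

theorem measure_univ_cubicTowers (hd : d ≠ 0) : (cubicTowers d hl).measure Set.univ = ⊤ := by
  refine (cubicTowers d hl).measure_univ_eq_top fun q => ⟨q + 1, ?_⟩
  calc q * ∏ k ∈ Finset.range (q + 1), ((cubicTowers d hl).C k).card
      = q * (∏ k ∈ Finset.range (q + 1), l k) ^ d := by
        simp only [card_C_cubicTowers, Finset.prod_pow]
    _ ≤ (3 ^ q) ^ d * (∏ k ∈ Finset.range (q + 1), l k) ^ d := by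
        gcongr
        exact (Nat.lt_pow_self (by norm_num)).le.trans (Nat.le_self_pow hd _)
    _ = (modulus l (q + 1) / 3) ^ d := by
        rw [modulus_succ_div_three, modulus_eq_pow_mul_prod, mul_assoc, ← Finset.prod_range_succ,
          mul_pow]
    _ ≤ (2 * (modulus l (q + 1) / 3) + 1) ^ d := by gcongr; omega
    _ = ((cubicTowers d hl).F (q + 1)).card := (card_centeredCube _ _).symm

theorem card_C_sdiff_vadd_cubicTowers (n : ℕ) (p : Fin d → ℤ) :
    ((cubicTowers d hl).C n \ ((modulus l n • p) +ᵥ (cubicTowers d hl).C n)).card =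
      (cube d (l n) \ (p +ᵥ cube d (l n))).card := by
  have hinj := nsmul_right_injective (M := Fin d → ℤ) (modulus_pos hl n).ne'
  have hvadd : (modulus l n • p) +ᵥ (cubicTowers d hl).C n =
      (p +ᵥ cube d (l n)).image (modulus l n • ·) :=
    (Finset.image_vadd_distrib (nsmulAddMonoidHom (α := Fin d → ℤ) (modulus l n)) p _).symm
  rw [hvadd]
  exact (congrArg _ (Finset.image_sdiff _ _ hinj).symm).trans
    (Finset.card_image_of_injective _ hinj)

theorem isRigidAlong_cubicTowers (h : ∀ n : ℕ,
    IsAlmostInvariantCube d (1 / ((n + 1) * (modulus l n + 1))) (l n)) (θ : Directions d) :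
    IsRigidAlong (cubicTowers d hl).measure θ := by
  choose p hp0 hpθ hcard using fun n => h n θ
  have hm (n : ℕ) : modulus l n ≠ 0 := (modulus_pos hl n).ne'
  have hlim : Tendsto (fun n : ℕ => 1 / ((n : ℝ) + 1)) atTop (𝓝 0) :=
    tendsto_one_div_add_atTop_nhds_zero_nat
  refine (cubicTowers d hl).isRigidAlong (γ := fun n => modulus l n • p n)
    (δ := fun n : ℕ => ENNReal.ofReal (1 / ((n : ℝ) + 1))) (fun n i _ => ?_)
    (fun n => smul_ne_zero (hm n) (hp0 n))
    (squeeze_zero (fun _ => Metric.infDist_nonneg) (fun n => ?_) hlim) ?_ fun n => ?_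
  · exact Int.mem_zmultiples_iff.2 ⟨p n i, by simp⟩
  · calc Metric.infDist (latticePoint (modulus l n • p n)) θ.submodule
        = modulus l n * Metric.infDist (latticePoint (p n)) θ.submodule :=
          infDist_latticePoint_nsmul (hm n) _ _
      _ ≤ (modulus l n + 1) * (1 / ((n + 1) * (modulus l n + 1))) := by
          gcongr
          exacts [Metric.infDist_nonneg, (lt_add_one _).le, hpθ n]
      _ = 1 / ((n : ℝ) + 1) := by field_simp
  · simpa using ENNReal.tendsto_ofReal hlim
  · rw [card_C_sdiff_vadd_cubicTowers, card_C_cubicTowers, ← card_cube,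
      ← ENNReal.ofReal_natCast, ← ENNReal.ofReal_natCast (cube d (l n)).card,
      ← ENNReal.ofReal_mul (by positivity)]
    refine ENNReal.ofReal_le_ofReal ((hcard n).trans ?_)
    gcongr
    exact le_mul_of_one_le_right (by positivity) (le_add_of_nonneg_left (Nat.cast_nonneg _))

end CubicTowers

theorem exists_rigidDirections_eq_univ {d : ℕ} (hd : d ≠ 0) :
    ∃ D : CutAndStack (Fin d → ℤ), D.measure Set.univ = ⊤ ∧ IsRankOne d D.measure ∧
      rigidDirections d D.measure = Set.univ := by
  obtain ⟨l, hl⟩ := exists_forall_modulus fun n m =>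
    exists_isAlmostInvariantCube d (ε := 1 / ((n + 1) * (m + 1))) (by positivity)
  have hpos (n : ℕ) : 0 < l n := (hl n).1
  exact ⟨cubicTowers d hpos, measure_univ_cubicTowers hpos hd, isRankOne_cubicTowers hpos,
    Set.eq_univ_of_forall (isRigidAlong_cubicTowers hpos fun n => (hl n).2)⟩

end DirectionalRecurrence

theorem theorem4p3 (d : ℕ) (hd : 1 ≤ d) :
    (∃ (X : Type) (_ : MeasurableSpace X) (_ : StandardBorelSpace X)
        (_ : AddAction (Fin d → ℤ) X) (_ : MeasurableConstVAdd (Fin d → ℤ) X)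
        (μ : Measure X) (_ : SigmaFinite μ) (_ : VAddInvariantMeasure (Fin d → ℤ) X μ),
        μ Set.univ = ⊤ ∧
        DirectionalRecurrence.IsFreeAction d X ∧
        DirectionalRecurrence.IsRankOne d μ ∧
        DirectionalRecurrence.recurrentDirections d μ = Set.univ) ∧
    (∃ (X : Type) (_ : MeasurableSpace X) (_ : StandardBorelSpace X)
        (_ : AddAction (Fin d → ℤ) X) (_ : MeasurableConstVAdd (Fin d → ℤ) X)
        (μ : Measure X) (_ : SigmaFinite μ) (_ : VAddInvariantMeasure (Fin d → ℤ) X μ),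
        μ Set.univ = ⊤ ∧
        DirectionalRecurrence.IsFreeAction d X ∧
        DirectionalRecurrence.IsRankOne d μ ∧
        DirectionalRecurrence.rigidDirections d μ = Set.univ) := by
  obtain ⟨D, htop, hrank, hrig⟩ :=
    DirectionalRecurrence.exists_rigidDirections_eq_univ (Nat.one_le_iff_ne_zero.1 hd)
  have hrec : DirectionalRecurrence.recurrentDirections d D.measure = Set.univ :=
    Set.univ_subset_iff.1 (hrig ▸
      DirectionalRecurrence.rigidDirections_subset_recurrentDirections D.measure)
  exact ⟨⟨D.Space, _, inferInstance, _, inferInstance, D.measure, inferInstance, inferInstance,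
      htop, D.isFreeAction, hrank, hrec⟩,
    ⟨D.Space, _, inferInstance, _, inferInstance, D.measure, inferInstance, inferInstance,
      htop, D.isFreeAction, hrank, hrig⟩⟩
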